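/- Let $D=(V,E)$ be a finite directed graph, possibly with loops and multiple edges. For an edge $e$ let $\mathbf x_e=\mathbf 1_{\mathrm{head}(e)}-\mathbf 1_{\mathrm{tail}(e)}\in\mathbb R^V$ (so $\mathbf x_e=\mathbf 0$ if $e$ is a loop), and let $$\tilde{\mathcal Q}_D=\operatorname{conv}\bigl(\{\mathbf 0\}\cup\{\mathbf x_e\mid e\in E\}\bigr)\subset\mathbb R^V$$ be the extended root polytope of $D$. Let $h^*_D$ denote its $h^*$-polynomial, that is, $$h^*_D(t)=(1-t)^{d+1}\sum_{k\ge 0}\bigl|(k\,\tilde{\mathcal Q}_D)\cap\mathbb Z^V\bigr|\,t^k,\qquad d=\dim\tilde{\mathcal Q}_D .$$ Suppose that $D$ is weakly connected, i.e. that its underlying undirected graph is connected, and let $e$ be an edge of $D$. Write $D-e$ for the digraph obtained from $D$ by deleting the edge $e$ and keeping all vertices. Then $h^*_D=h^*_{D-e}$ if and only if at least one of the following holds: $e$ is a loop; $e$ is a bridge (there is a partition of $V$ into two nonempty parts such that $e$ is the only edge of $D$, in either direction, between the two parts); or $e$ has a parallel edge, i.e. there is an edge $f\ne e$ with the same tail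 and the same head as $e$. -/

import Mathlib

open scoped Pointwise

noncomputable section

/-- The dimension of (the affine hull of) a set `Q ⊆ ℝ^ι`. -/
def polytopeDim {ι : Type*} (Q : Set (ι → ℝ)) : ℕ :=
  Module.finrank ℝ (vectorSpan ℝ Q)

/-- The number of lattice points `|(k • Q) ∩ ℤ^ι|` in the `k`-th dilate of `Q`. -/
def latticePointCount {ι : Type*} (Q : Set (ι → ℝ)) (k : ℕ) : ℕ :=
  Set.ncard {z : ι → ℤ | (fun i => (z i : ℝ)) ∈ (k : ℝ) • Q}

/-- The Ehrhart series `∑_{k ≥ 0} |(k • Q) ∩ ℤ^ι| t^k`. -/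
def ehrhartSeries {ι : Type*} (Q : Set (ι → ℝ)) : PowerSeries ℤ :=
  PowerSeries.mk fun k => (latticePointCount Q k : ℤ)

/-- The `h^*`-polynomial `(1 - t)^(d + 1) * Ehr_Q(t)` of a `d`-dimensional lattice polytope `Q`.
It is given by the defining identity in the ring `ℤ⟦t⟧`, which contains `ℤ[t]`, so that two
`h^*`-polynomials are equal exactly when they are equal here. -/
def hStar {ι : Type*} (Q : Set (ι → ℝ)) : PowerSeries ℤ :=
  (1 - PowerSeries.X) ^ (polytopeDim Q + 1) * ehrhartSeries Q

/-- A directed graph with vertex set `V` and edge set `E`; loops and multiple edges are allowed. -/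
structure MultiDigraph (V E : Type*) where
  /-- The tail (starting vertex) of an edge. -/
  tail : E → V
  /-- The head (end vertex) of an edge. -/
  head : E → V

namespace MultiDigraph

variable {V E : Type*}

/-- The digraph `D - e` with the edge `e` deleted (and all vertices kept). -/
def deleteEdge (D : MultiDigraph V E) (e : E) : MultiDigraph V {f : E // f ≠ e} where
  tail f := D.tail f
  head f := D.head f

/-- `D` is weakly connected: the undirected graph obtained by forgetting orientations (and
multiplicities and loops, which do not matter for connectedness) is connected. -/
def WeaklyConnected (D : MultiDigraph V E) : Prop :=
  (SimpleGraph.fromRel fun u v : V => ∃ f : E, D.tail f = u ∧ D.head f = v).Connected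

/-- `e` is a loop. -/
def IsLoop (D : MultiDigraph V E) (e : E) : Prop :=
  D.tail e = D.head e

/-- `e` and `f` are parallel: distinct edges with the same tail and the same head. -/
def Parallel (D : MultiDigraph V E) (e f : E) : Prop :=
  e ≠ f ∧ D.tail e = D.tail f ∧ D.head e = D.head f

/-- `C` is a cut: the set of all edges between the two (nonempty) parts `S` and `Sᶜ` of a
partition of the vertex set, in either direction. -/
def IsCut (D : MultiDigraph V E) (C : Set E) : Prop :=
  ∃ S : Set V, S.Nonempty ∧ Sᶜ.Nonempty ∧
    C = {f : E | (D.tail f ∈ S ∧ D.head f ∉ S) ∨ (D.tail f ∉ S ∧ D.head f ∈ S)}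

/-- `e` is a bridge: it forms a one-element cut. -/
def IsBridge (D : MultiDigraph V E) (e : E) : Prop :=
  D.IsCut {e}

/-- The vector `x_e = 1_{head e} - 1_{tail e}`; it is `0` if `e` is a loop. -/
def edgeVector [DecidableEq V] (D : MultiDigraph V E) (e : E) : V → ℝ :=
  Pi.single (D.head e) 1 - Pi.single (D.tail e) 1

/-- The extended root polytope `conv ({0} ∪ {x_e | e ∈ E})`. -/
def extendedRootPolytope [DecidableEq V] (D : MultiDigraph V E) : Set (V → ℝ) :=
  convexHull ℝ ({0} ∪ Set.range D.edgeVector)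

end MultiDigraph

end

/-! Deleting a loop, or an edge with a parallel, leaves the polytope unchanged. For a bridge,
summing coordinates over one side of the cut gives, up to sign, an integral functional that is 1 on
x_e and 0 on all other generators. So the polytope is a pyramid of lattice height one over that of D
- e: the Ehrhart series gets divided by 1 - t while the dimension grows by one, and h^* is unchanged
(`hStar_pyramid`). Conversely, if e is not a bridge, both polytopes have the same dimension; if it
is also neither a loop nor parallel to another edge, x_e is a new lattice point, so the linear
coefficients of the Ehrhart series differ (`hStar_ne_of_lattice_point`). -/

section LatticePyramid

/-! ### Ehrhart series of lattice pyramids -/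

variable {ι : Type*}

/-- The lattice points of the dilate `k • Q`. -/
def latticePoints (Q : Set (ι → ℝ)) (k : ℕ) : Set (ι → ℤ) :=
  {z | (fun i => (z i : ℝ)) ∈ (k : ℝ) • Q}

theorem latticePointCount_eq_ncard (Q : Set (ι → ℝ)) (k : ℕ) :
    latticePointCount Q k = (latticePoints Q k).ncard := rfl

/-- Guards the counts against the junk value 0 of `Set.ncard` on infinite sets. -/
theorem finite_latticePoints [Fintype ι] {Q : Set (ι → ℝ)} (hQ : Bornology.IsBounded Q) (k : ℕ) :
    (latticePoints Q k).Finite := by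
  obtain ⟨R, hR⟩ := (hQ.smul₀ (k : ℝ)).subset_closedBall 0
  refine (Set.Finite.pi' fun _ : ι => Set.finite_Icc (-⌈R⌉) ⌈R⌉).subset fun z hz i => ?_
  have h1 : ‖fun i => (z i : ℝ)‖ ≤ R := by simpa using hR hz
  have h2 : |(z i : ℝ)| ≤ R := (norm_le_pi_norm (fun i => (z i : ℝ)) i).trans h1
  have h3 : |(z i : ℝ)| ≤ (⌈R⌉ : ℤ) := h2.trans (Int.le_ceil R)
  rw [abs_le] at h3
  exact ⟨by exact_mod_cast h3.1, by exact_mod_cast h3.2⟩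

theorem latticePointCount_zero {Q : Set (ι → ℝ)} (hQ : Q.Nonempty) :
    latticePointCount Q 0 = 1 := by
  rw [latticePointCount_eq_ncard, Set.ncard_eq_one]
  refine ⟨0, Set.ext fun z => ?_⟩
  simp only [latticePoints, Nat.cast_zero, Set.zero_smul_set hQ, Set.mem_ofPred_eq, Set.mem_zero,
    Set.mem_singleton_iff, funext_iff, Pi.zero_apply, Int.cast_eq_zero]

theorem polytopeDim_convexHull_insert_zero (S : Set (ι → ℝ)) :
    polytopeDim (convexHull ℝ (insert 0 S)) = Module.finrank ℝ (Submodule.span ℝ S) := by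
  rw [polytopeDim, ← direction_affineSpan, affineSpan_convexHull, direction_affineSpan,
    vectorSpan_eq_span_vsub_set_right ℝ (Set.mem_insert 0 S)]
  have h : (· -ᵥ (0 : ι → ℝ)) '' insert 0 S = insert 0 S :=
    (Set.image_congr fun x _ => sub_zero x).trans (Set.image_id' _)
  rw [h, Submodule.span_insert_zero]

theorem mem_smul_convexHull_insert {S : Set (ι → ℝ)} (hS : S.Nonempty) (v x : ι → ℝ) (k : ℕ) :
    x ∈ (k : ℝ) • convexHull ℝ (insert v S) ↔
      ∃ a b : ℝ, 0 ≤ a ∧ 0 ≤ b ∧ a + b = k ∧ ∃ y ∈ convexHull ℝ S, x = a • v + b • y := by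
  simp only [convexHull_insert hS, Set.mem_smul_set, mem_convexJoin, Set.mem_singleton_iff,
    exists_eq_left, segment, Set.mem_ofPred_eq]
  constructor
  · rintro ⟨_, ⟨y, hy, a, b, ha, hb, hab, rfl⟩, rfl⟩
    refine ⟨k * a, k * b, by positivity, by positivity, ?_, y, hy, ?_⟩
    · rw [← mul_add, hab, mul_one]
    · rw [smul_add, smul_smul, smul_smul]
  · rintro ⟨a, b, ha, hb, hab, y, hy, rfl⟩
    -- Rescaling the weights by 1 / k fails for k = 0, where both weights vanish.
    rcases eq_or_ne k 0 with rfl | hk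
    · have ha0 : a = 0 := by push_cast at hab; linarith
      have hb0 : b = 0 := by push_cast at hab; linarith
      exact ⟨y, ⟨y, hy, 0, 1, le_rfl, zero_le_one, by simp, by simp⟩, by simp [ha0, hb0]⟩
    · have hk' : (k : ℝ) ≠ 0 := Nat.cast_ne_zero.2 hk
      refine ⟨_, ⟨y, hy, a / k, b / k, by positivity, by positivity, ?_, rfl⟩, ?_⟩
      · rw [← add_div, hab, div_self hk']
      · rw [smul_add, smul_smul, smul_smul, mul_div_cancel₀ _ hk', mul_div_cancel₀ _ hk']

/-- The lattice points of a dilate of a lattice pyramid of height one either lie in the base or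
are translates by the apex of lattice points of the preceding dilate. -/
theorem latticePoints_pyramid_succ {S : Set (ι → ℝ)} (hS : S.Nonempty) (v : ι → ℤ)
    (φ : (ι → ℝ) →ₗ[ℝ] ℝ) (hφ : ∀ z : ι → ℤ, ∃ n : ℤ, φ (fun i => (z i : ℝ)) = n)
    (hv : φ (fun i => (v i : ℝ)) = 1) (hφS : ∀ y ∈ convexHull ℝ S, φ y = 0) (k : ℕ) :
    latticePoints (convexHull ℝ (insert (fun i => (v i : ℝ)) S)) (k + 1) =
      (· + v) '' latticePoints (convexHull ℝ (insert (fun i => (v i : ℝ)) S)) k ∪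
        latticePoints (convexHull ℝ S) (k + 1) := by
  ext z
  constructor
  · intro hz
    obtain ⟨a, b, ha, hb, hab, y, hy, hzy⟩ := (mem_smul_convexHull_insert hS _ _ _).1 hz
    obtain ⟨n, hn⟩ := hφ z
    have han : a = n := by rw [← hn, hzy]; simp [hv, hφS y hy]
    have hn0 : 0 ≤ n := by rw [han] at ha; exact_mod_cast ha
    -- The apex weight `a` equals the height `φ z`, hence is an integer: either 0, or large enough
    -- to remove one copy of `v`.
    rcases hn0.eq_or_lt with h0 | h0
    · right
      have ha0 : a = 0 := by rw [han, ← h0, Int.cast_zero]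
      exact ⟨y, hy, by rw [hzy, ha0, zero_smul, zero_add, ← hab, ha0, zero_add]⟩
    · left
      have ha1 : 1 ≤ a := by rw [han]; exact_mod_cast h0
      refine ⟨z - v, (mem_smul_convexHull_insert hS _ _ _).2
        ⟨a - 1, b, by linarith, hb, by push_cast at hab; linarith, y, hy, ?_⟩,
        sub_add_cancel z v⟩
      funext i
      have := congrFun hzy i
      simp only [Pi.add_apply, Pi.smul_apply, smul_eq_mul, Pi.sub_apply, Int.cast_sub] at this ⊢
      rw [this]; ring
  · rintro (⟨w, hw, rfl⟩ | hz)
    · obtain ⟨a, b, ha, hb, hab, y, hy, hwy⟩ := (mem_smul_convexHull_insert hS _ _ _).1 hw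
      refine (mem_smul_convexHull_insert hS _ _ _).2
        ⟨a + 1, b, by linarith, hb, by push_cast; linarith, y, hy, ?_⟩
      funext i
      have := congrFun hwy i
      simp only [Pi.add_apply, Pi.smul_apply, smul_eq_mul, Int.cast_add] at this ⊢
      rw [this]; ring
    · exact Set.smul_set_mono (convexHull_mono (Set.subset_insert _ _)) hz

theorem latticePointCount_pyramid_succ [Fintype ι] {S : Set (ι → ℝ)} (hS : S.Nonempty)
    (hb : Bornology.IsBounded S) (v : ι → ℤ)
    (φ : (ι → ℝ) →ₗ[ℝ] ℝ) (hφ : ∀ z : ι → ℤ, ∃ n : ℤ, φ (fun i => (z i : ℝ)) = n)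
    (hv : φ (fun i => (v i : ℝ)) = 1) (hφS : ∀ y ∈ convexHull ℝ S, φ y = 0) (k : ℕ) :
    latticePointCount (convexHull ℝ (insert (fun i => (v i : ℝ)) S)) (k + 1) =
      latticePointCount (convexHull ℝ (insert (fun i => (v i : ℝ)) S)) k +
        latticePointCount (convexHull ℝ S) (k + 1) := by
  have hb' : Bornology.IsBounded (convexHull ℝ (insert (fun i => (v i : ℝ)) S)) :=
    isBounded_convexHull.2 (hb.insert _)
  simp only [latticePointCount_eq_ncard]
  rw [latticePoints_pyramid_succ hS v φ hφ hv hφS, Set.ncard_union_eq ?_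
    ((finite_latticePoints hb' k).image _)
    (finite_latticePoints (isBounded_convexHull.2 hb) _),
    Set.ncard_image_of_injective _ (add_left_injective v)]
  -- Translates by `v` have height at least 1, base points height 0.
  rw [Set.disjoint_left]
  rintro _ ⟨w, hw, rfl⟩ ⟨y, hy, hwy⟩
  obtain ⟨a, b, ha, -, -, y', hy', hwy'⟩ := (mem_smul_convexHull_insert hS _ _ _).1 hw
  have h1 : φ (fun i => (w i : ℝ)) = a := by rw [hwy']; simp [hv, hφS y' hy']
  have h2 : (fun i => ((w + v) i : ℝ)) = (fun i => (w i : ℝ)) + fun i => (v i : ℝ) := by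
    funext i; simp
  have h3 := congrArg φ hwy
  simp only [h2, map_smul, hφS y hy, map_add, h1, hv, smul_zero] at h3
  linarith

/-- A lattice pyramid of height one has the same `h^*`-polynomial as its base. -/
theorem hStar_pyramid [Fintype ι] {S : Set (ι → ℝ)} (hb : Bornology.IsBounded S) (v : ι → ℤ)
    (φ : (ι → ℝ) →ₗ[ℝ] ℝ) (hφ : ∀ z : ι → ℤ, ∃ n : ℤ, φ (fun i => (z i : ℝ)) = n)
    (hv : φ (fun i => (v i : ℝ)) = 1) (hφS : ∀ y ∈ S, φ y = 0) :
    hStar (convexHull ℝ (insert 0 (insert (fun i => (v i : ℝ)) S))) =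
      hStar (convexHull ℝ (insert 0 S)) := by
  have hspan : Submodule.span ℝ S ≤ LinearMap.ker φ := Submodule.span_le.2 hφS
  have hdim : polytopeDim (convexHull ℝ (insert 0 (insert (fun i => (v i : ℝ)) S))) =
      polytopeDim (convexHull ℝ (insert 0 S)) + 1 := by
    rw [polytopeDim_convexHull_insert_zero, polytopeDim_convexHull_insert_zero,
      Submodule.span_insert, sup_comm, Submodule.finrank_sup_span_singleton]
    intro h
    have := LinearMap.mem_ker.1 (hspan h)
    linarith
  have hφ0 : ∀ y ∈ convexHull ℝ (insert 0 S), φ y = 0 := fun y hy =>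
    LinearMap.mem_ker.1 <| convexHull_min
      (Set.insert_subset (LinearMap.ker φ).zero_mem hφS) (LinearMap.ker φ).convex hy
  have hne : (insert (0 : ι → ℝ) S).Nonempty := Set.insert_nonempty _ _
  have hser : (1 - PowerSeries.X) *
      ehrhartSeries (convexHull ℝ (insert 0 (insert (fun i => (v i : ℝ)) S))) =
      ehrhartSeries (convexHull ℝ (insert 0 S)) := by
    -- The apex is `v`; the origin belongs to the base.
    rw [Set.insert_comm]
    ext k
    rw [sub_mul, one_mul, map_sub]
    cases k with
    | zero =>
      simp [ehrhartSeries, latticePointCount_zero hne.convexHull,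
        latticePointCount_zero (hne.mono (Set.subset_insert _ _)).convexHull]
    | succ k =>
      rw [PowerSeries.coeff_succ_X_mul]
      simp only [ehrhartSeries, PowerSeries.coeff_mk]
      rw [latticePointCount_pyramid_succ hne (hb.insert 0) v φ hφ hv hφ0]
      push_cast
      ring
  rw [hStar, hStar, hdim, pow_succ, mul_assoc, hser]

/-- Polytopes of equal dimension, one strictly larger than the other in terms of lattice points,
have different `h^*`-polynomials. -/
theorem hStar_ne_of_lattice_point [Fintype ι] {P Q : Set (ι → ℝ)} (hQ : Bornology.IsBounded Q)
    (hPQ : P ⊆ Q) (hdim : polytopeDim P = polytopeDim Q) (v : ι → ℤ)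
    (hvQ : (fun i => (v i : ℝ)) ∈ Q) (hvP : (fun i => (v i : ℝ)) ∉ P) : hStar Q ≠ hStar P := by
  intro h
  rw [hStar, hStar, hdim] at h
  have hX : (1 - PowerSeries.X : PowerSeries ℤ) ≠ 0 := fun h0 => by
    simpa using congrArg (PowerSeries.coeff 0) h0
  have h1 := congrArg (PowerSeries.coeff 1) (mul_left_cancel₀ (pow_ne_zero _ hX) h)
  simp only [ehrhartSeries, PowerSeries.coeff_mk, Nat.cast_inj, latticePointCount_eq_ncard] at h1
  have hsub : latticePoints P 1 ⊆ latticePoints Q 1 := fun _ hz => Set.smul_set_mono hPQ hz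
  have hss : latticePoints P 1 ⊂ latticePoints Q 1 :=
    (Set.ssubset_iff_of_subset hsub).2
      ⟨v, by simpa [latticePoints] using hvQ, by simpa [latticePoints] using hvP⟩
  exact (Set.ncard_lt_ncard hss (finite_latticePoints hQ 1)).ne' h1

end LatticePyramid

/-! ### Root polytopes and edge deletion -/

namespace MultiDigraph

variable {V E : Type*} [DecidableEq V]

theorem extendedRootPolytope_eq (D : MultiDigraph V E) :
    D.extendedRootPolytope = convexHull ℝ (insert 0 (Set.range D.edgeVector)) := rfl

theorem edgeVector_eq_intCast (D : MultiDigraph V E) (e : E) :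
    D.edgeVector e = fun i =>
      (((Pi.single (D.head e) 1 - Pi.single (D.tail e) 1 : V → ℤ) i : ℤ) : ℝ) := by
  funext i
  simp [edgeVector, Pi.single_apply]

theorem range_edgeVector_eq_insert (D : MultiDigraph V E) (e : E) :
    Set.range D.edgeVector =
      insert (D.edgeVector e) (Set.range (D.deleteEdge e).edgeVector) := by
  ext x
  simp only [Set.mem_range, Set.mem_insert_iff]
  constructor
  · rintro ⟨f, rfl⟩
    by_cases hf : f = e
    · exact .inl (by rw [hf])
    · exact .inr ⟨⟨f, hf⟩, rfl⟩
  · rintro (rfl | ⟨f, rfl⟩)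
    · exact ⟨e, rfl⟩
    · exact ⟨f, rfl⟩

theorem extendedRootPolytope_deleteEdge_of_isLoop {D : MultiDigraph V E} {e : E}
    (h : D.IsLoop e) : (D.deleteEdge e).extendedRootPolytope = D.extendedRootPolytope := by
  have h0 : D.edgeVector e = 0 := by rw [edgeVector, show D.tail e = D.head e from h, sub_self]
  rw [extendedRootPolytope_eq, extendedRootPolytope_eq, D.range_edgeVector_eq_insert e, h0,
    Set.insert_eq_of_mem (Set.mem_insert _ _)]

theorem extendedRootPolytope_deleteEdge_of_parallel {D : MultiDigraph V E} {e f : E}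
    (h : D.Parallel e f) : (D.deleteEdge e).extendedRootPolytope = D.extendedRootPolytope := by
  have h0 : D.edgeVector e ∈ Set.range (D.deleteEdge e).edgeVector :=
    ⟨⟨f, h.1.symm⟩, by simp only [edgeVector, deleteEdge, h.2.1, h.2.2]⟩
  rw [extendedRootPolytope_eq, extendedRootPolytope_eq, D.range_edgeVector_eq_insert e,
    Set.insert_eq_of_mem h0]

/-- If `e` is not a bridge, then `x_e` is a linear combination of the vectors of the other
edges. -/
theorem edgeVector_mem_span_of_not_isBridge {D : MultiDigraph V E} {e : E}
    (h : ¬ D.IsBridge e) :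
    D.edgeVector e ∈ Submodule.span ℝ (Set.range (D.deleteEdge e).edgeVector) := by
  by_contra hmem
  set W := Submodule.span ℝ (Set.range (D.deleteEdge e).edgeVector) with hW
  -- Vertices whose basis vector agrees with that of the tail modulo `W`. An edge other than `e`
  -- cannot leave this class, so `e` alone would cross the cut.
  let S : Set V := {u | (Pi.single u 1 - Pi.single (D.tail e) 1 : V → ℝ) ∈ W}
  have htail : D.tail e ∈ S := by simp [S]
  have hhead : D.head e ∉ S := hmem
  refine h ⟨S, ⟨_, htail⟩, ⟨_, hhead⟩, Set.ext fun f => ?_⟩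
  simp only [Set.mem_singleton_iff, Set.mem_ofPred_eq]
  constructor
  · rintro rfl
    exact .inl ⟨htail, hhead⟩
  · intro hf
    by_contra hfe
    have hfW : (Pi.single (D.head f) 1 - Pi.single (D.tail f) 1 : V → ℝ) ∈ W :=
      Submodule.subset_span ⟨⟨f, hfe⟩, rfl⟩
    have hiff : D.head f ∈ S ↔ D.tail f ∈ S := by
      simp only [S, Set.mem_ofPred_eq]
      rw [← W.add_mem_iff_right hfW (y := Pi.single (D.tail f) 1 - Pi.single (D.tail e) 1),
        sub_add_sub_cancel]
    tauto

/-- A non-loop edge without parallel edges is not in the extended root polytope of the others. -/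
theorem edgeVector_notMem_extendedRootPolytope_deleteEdge {D : MultiDigraph V E} {e : E}
    (hl : ¬ D.IsLoop e) (hp : ¬ ∃ f, D.Parallel e f) :
    D.edgeVector e ∉ (D.deleteEdge e).extendedRootPolytope := by
  intro hmem
  have hne : D.tail e ≠ D.head e := hl
  -- This functional is 2 on x_e, but at most 1 on 0 and on every edge vector whose head and tail do
  -- not both match those of `e`.
  let g : (V → ℝ) →ₗ[ℝ] ℝ :=
    LinearMap.proj (R := ℝ) (φ := fun _ : V => ℝ) (D.head e) - LinearMap.proj (D.tail e)
  have hg : ∀ x, g x = x (D.head e) - x (D.tail e) := fun _ => rfl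
  have hle : D.edgeVector e ∈ {x | g x ≤ 1} := by
    refine convexHull_min ?_ (convex_halfSpace_le g.isLinear 1) hmem
    rintro x (rfl | ⟨⟨f, hf⟩, rfl⟩)
    · simp
    · have hnp : ¬ (D.tail e = D.tail f ∧ D.head e = D.head f) := fun h =>
        hp ⟨f, hf.symm, h⟩
      simp only [Set.mem_ofPred_eq, hg, edgeVector, deleteEdge, Pi.sub_apply, Pi.single_apply]
      split_ifs <;> first | (norm_num; done) | exact absurd ⟨‹_›, ‹_›⟩ hnp
  simp only [Set.mem_ofPred_eq, hg, edgeVector, Pi.sub_apply, Pi.single_eq_same,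
    Pi.single_eq_of_ne hne, Pi.single_eq_of_ne hne.symm] at hle
  norm_num at hle

theorem isBounded_range_edgeVector [Finite E] (D : MultiDigraph V E) [Fintype V] :
    Bornology.IsBounded (Set.range D.edgeVector) :=
  (Set.finite_range _).isBounded

theorem IsBridge.exists_functional [Fintype V] {D : MultiDigraph V E} {e : E}
    (h : D.IsBridge e) : ∃ φ : (V → ℝ) →ₗ[ℝ] ℝ,
      (∀ z : V → ℤ, ∃ n : ℤ, φ (fun i => (z i : ℝ)) = n) ∧ φ (D.edgeVector e) = 1 ∧
        ∀ f, f ≠ e → φ (D.edgeVector f) = 0 := by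
  classical
  obtain ⟨S, -, -, hS⟩ := h
  let ψ : (V → ℝ) →ₗ[ℝ] ℝ := ∑ u, if u ∈ S then LinearMap.proj u else 0
  have hψ : ∀ x, ψ x = ∑ u, if u ∈ S then x u else 0 := fun x => by
    simp only [ψ, LinearMap.sum_apply]
    exact Finset.sum_congr rfl fun u _ => by split_ifs <;> rfl
  have hint : ∀ z : V → ℤ, ∃ n : ℤ, ψ (fun i => (z i : ℝ)) = n := fun z =>
    ⟨∑ u, if u ∈ S then z u else 0, by rw [hψ]; push_cast; rfl⟩
  have hsingle : ∀ u, ψ (Pi.single u 1) = if u ∈ S then 1 else 0 := fun u => by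
    rw [hψ, Finset.sum_eq_single u]
    · simp
    · intro w _ hw; simp [hw]
    · simp
  have hedge : ∀ f, ψ (D.edgeVector f) =
      (if D.head f ∈ S then 1 else 0) - (if D.tail f ∈ S then 1 else 0) := fun f => by
    rw [edgeVector, map_sub, hsingle, hsingle]
  have hother : ∀ f, f ≠ e → ψ (D.edgeVector f) = 0 := fun f hf => by
    have hmem : f ∉ ({e} : Set E) := hf
    rw [hS, Set.mem_ofPred_eq] at hmem
    rw [hedge]
    by_cases h1 : D.head f ∈ S <;> by_cases h2 : D.tail f ∈ S <;> simp_all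
  have hmem : e ∈ ({e} : Set E) := rfl
  rw [hS] at hmem
  rcases hmem with ⟨h1, h2⟩ | ⟨h1, h2⟩
  -- Here `e` leaves `S`, so the sign is flipped to get height +1.
  · refine ⟨-ψ, fun z => ?_, by simp [hedge, h1, h2], fun f hf => by simp [hother f hf]⟩
    obtain ⟨n, hn⟩ := hint z
    exact ⟨-n, by simp [hn]⟩
  · exact ⟨ψ, hint, by simp [hedge, h1, h2], hother⟩

theorem IsBridge.hStar_deleteEdge [Fintype V] [Finite E] {D : MultiDigraph V E} {e : E}
    (h : D.IsBridge e) :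
    hStar D.extendedRootPolytope = hStar (D.deleteEdge e).extendedRootPolytope := by
  obtain ⟨φ, hφ, hφe, hφf⟩ := h.exists_functional
  rw [extendedRootPolytope_eq, extendedRootPolytope_eq, D.range_edgeVector_eq_insert e]
  rw [edgeVector_eq_intCast] at hφe ⊢
  refine hStar_pyramid (isBounded_range_edgeVector _) _ φ hφ hφe ?_
  rintro _ ⟨f, rfl⟩
  exact hφf f f.2

theorem hStar_ne_hStar_deleteEdge [Fintype V] [Finite E] {D : MultiDigraph V E} {e : E}
    (hl : ¬ D.IsLoop e) (hb : ¬ D.IsBridge e) (hp : ¬ ∃ f, D.Parallel e f) :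
    hStar D.extendedRootPolytope ≠ hStar (D.deleteEdge e).extendedRootPolytope := by
  have hsub : insert 0 (Set.range (D.deleteEdge e).edgeVector) ⊆
      insert 0 (Set.range D.edgeVector) :=
    Set.insert_subset_insert (by
      rw [D.range_edgeVector_eq_insert e]; exact Set.subset_insert _ _)
  refine hStar_ne_of_lattice_point
    (isBounded_convexHull.2 (D.isBounded_range_edgeVector.insert 0)) (convexHull_mono hsub) ?_
    (Pi.single (D.head e) 1 - Pi.single (D.tail e) 1) ?_ ?_
  · rw [extendedRootPolytope_eq, polytopeDim_convexHull_insert_zero]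
    refine .trans ?_ (polytopeDim_convexHull_insert_zero _).symm
    rw [D.range_edgeVector_eq_insert e,
      Submodule.span_insert_eq_span (edgeVector_mem_span_of_not_isBridge hb)]
  · rw [← edgeVector_eq_intCast]
    exact subset_convexHull ℝ _ (.inr ⟨e, rfl⟩)
  · rw [← edgeVector_eq_intCast]
    exact edgeVector_notMem_extendedRootPolytope_deleteEdge hl hp

end MultiDigraph

theorem mainTheorem4 {V E : Type*} [Fintype V] [DecidableEq V] [Fintype E]
    (D : MultiDigraph V E) (hD : D.WeaklyConnected) (e : E) :
    hStar D.extendedRootPolytope = hStar (D.deleteEdge e).extendedRootPolytope ↔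
      D.IsLoop e ∨ D.IsBridge e ∨ ∃ f : E, D.Parallel e f := by
  constructor
  · intro h
    by_contra! hcon
    exact MultiDigraph.hStar_ne_hStar_deleteEdge hcon.1 hcon.2.1 (not_exists.2 hcon.2.2) h
  · rintro (h | h | ⟨f, h⟩)
    · rw [MultiDigraph.extendedRootPolytope_deleteEdge_of_isLoop h]
    · exact h.hStar_deleteEdge
    · rw [MultiDigraph.extendedRootPolytope_deleteEdge_of_parallel h]
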